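/- Let $\mathcal{F}_1,\dots,\mathcal{F}_4$ be finite families of compact convex sets in $\mathbb{R}^2$ such that for every choice of sets $A_1\in\mathcal{F}_1,\dots,A_4\in\mathcal{F}_4$ there is a line that intersects each of $A_1,A_2,A_3,A_4$. Let $v\in\mathbb{R}^2$ be a nonzero vector. Then there exist an index $1\le i\le 4$ and two distinct lines $\ell_1,\ell_2$ in $\mathbb{R}^2$ such that $\ell_1$ is parallel to $v$ and every set in $\mathcal{F}_i$ intersects $\ell_1\cup\ell_2$. -/

import Mathlib

namespace LinePiercing

/-- The Euclidean plane. -/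
abbrev Plane : Type := EuclideanSpace ℝ (Fin 2)

/-- A line in the plane: an affine subspace of dimension one
(such an affine subspace is automatically nonempty). -/
def IsLine (l : AffineSubspace ℝ Plane) : Prop :=
  Module.finrank ℝ l.direction = 1

/-- The set `X` pierces the family `F`: it meets every member of `F`. -/
def Pierces (X : Set Plane) (F : Set (Set Plane)) : Prop :=
  ∀ A ∈ F, (X ∩ A).Nonempty

end LinePiercing

/-! Choose coordinates `s`, `t` in which lines parallel to `v` are `t = const` and all sets lie in
the strip 1/4 ≤ t ≤ 3/4. A point `x` of the 3-simplex determines the line `t = height x` and the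
zero set of `tilt x`, which bound four open quadrants. If no family is pierced by a pair of lines as
required, then by convexity each family has, for every `x`, a member inside one quadrant; so each
family gives an open cover of the simplex by four sets. The coefficients of `tilt` are designed so
that quadrant `q` misses the strip on the facet `x q = 0` (`coord_ne_zero`). Colourful KKM
(`exists_perm_forall_mem`) then yields one `x` and one set per family, in four different quadrants.
A line through these sets would meet all four quadrants, which is impossible (`not_all_signs`).

Colourful KKM follows from Sperner's lemma modulo two: changing one label preserves the parity of
the number of fully labelled simplices, so every Sperner labelling has the parity of
`firstPositive`, which is 1. -/

namespace SimplexLattice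

open Finset

/-! ### Parity of fully labelled simplices in the Freudenthal triangulation -/

/-- The edge directions of the Freudenthal triangulation of the hyperplanes `∑ i, x i = N`. -/
def step (i : Fin 4) : Fin 4 → ℤ := Pi.single (i + 1) 1 - Pi.single i 1

/-- The offsets of the vertices of the simplex whose edges follow the directions in the order `σ`. -/
def offset (σ : Equiv.Perm (Fin 4)) : Fin 4 → Fin 4 → ℤ :=
  ![0, step (σ 0), step (σ 0) + step (σ 1), step (σ 0) + step (σ 1) + step (σ 2)]

/-- The colour of a lattice point; the vertices of a simplex have consecutive colours. -/
def color (x : Fin 4 → ℤ) : ZMod 4 := (x 1 : ZMod 4) + 2 * (x 2 : ZMod 4) + 3 * (x 3 : ZMod 4)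

/-- The indicator, modulo two, of four labels being distinct. -/
def rainbow (a b c d : Fin 4) : ZMod 2 :=
  if a ≠ b ∧ a ≠ c ∧ a ≠ d ∧ b ≠ c ∧ b ≠ d ∧ c ≠ d then 1 else 0

/-- The indicator, modulo two, of a simplex being fully labelled. -/
def fullyLabelled (l : (Fin 4 → ℤ) → Fin 4) (x : Fin 4 → ℤ) (σ : Equiv.Perm (Fin 4)) : ZMod 2 :=
  rainbow (l (x + offset σ 0)) (l (x + offset σ 1)) (l (x + offset σ 2)) (l (x + offset σ 3))

/-- The lattice points of the dilated simplex that have colour `k`. -/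
noncomputable def latticePoints (N : ℕ) (k : ZMod 4) : Finset (Fin 4 → ℤ) :=
  {x ∈ Fintype.piFinset fun _ => Icc (0 : ℤ) N | ∑ i, x i = N ∧ color x = k}

/-- The parity of the number of fully labelled simplices. -/
noncomputable def parity (N : ℕ) (k : ZMod 4) (l : (Fin 4 → ℤ) → Fin 4) : ZMod 2 :=
  ∑ x ∈ latticePoints N k, ∑ σ, fullyLabelled l x σ

/-- Sperner's boundary condition. -/
def IsSperner (N : ℕ) (l : (Fin 4 → ℤ) → Fin 4) : Prop :=
  ∀ x : Fin 4 → ℤ, ∑ i, x i = N → ∀ q, x q ≤ 0 → l x ≠ q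

theorem color_add (x y : Fin 4 → ℤ) : color (x + y) = color x + color y := by
  simp [color]; ring

theorem color_offset : ∀ σ k, color (offset σ k) = (k : ℕ) := by
  decide

theorem eq_zero_of_natCast_eq_zero : ∀ k : Fin 4, ((k : ℕ) : ZMod 4) = 0 → k = 0 := by
  decide

theorem sum_offset : ∀ σ k, ∑ i, offset σ k i = 0 := by
  decide

theorem offset_sub_offset_le : ∀ σ j k q, offset σ j q - offset σ k q ≤ 1 := by
  decide

/-- The four steps sum to zero, so the vertices form a closed cycle, and rotating `σ` reads it from
the next vertex. Each simplex thus has one description per base colour. -/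
theorem offset_rotate (σ : Equiv.Perm (Fin 4)) :
    ∀ k, offset σ 1 + offset (σ * finRotate 4) k = offset σ (k + 1) := by
  revert σ; decide

/-- These are the five facets of a 4-simplex with vertex labels `a, a', p, q, r`. If all four labels
occur, exactly one occurs twice, and deleting either copy gives the two rainbow facets; otherwise
there are none. -/
theorem rainbow_cocycle : ∀ a a' p q r, rainbow a p q r + rainbow a' p q r =
    rainbow a a' p q + rainbow a a' q r + rainbow a a' p r := by
  decide

theorem rainbow_rotate : ∀ a b c d, rainbow b c d a = rainbow a b c d := by
  decide

theorem rainbow_surjective : ∀ a b c d, rainbow a b c d ≠ 0 → ∀ q, ∃ k, ![a, b, c, d] k = q := by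
  decide

theorem rainbow_injective : ∀ a b c d, rainbow a b c d ≠ 0 →
    ∀ j k, ![a, b, c, d] j = ![a, b, c, d] k → j = k := by
  decide

theorem sum_perm_eq_zero_of_swap {i j : Fin 4} (hij : i ≠ j) (f : Equiv.Perm (Fin 4) → ZMod 2)
    (hf : ∀ σ, f (σ * Equiv.swap i j) = f σ) : ∑ σ, f σ = 0 := by
  refine Finset.sum_involution (fun σ _ => σ * Equiv.swap i j) (fun σ _ => ?_) (fun σ _ _ h => ?_)
    (fun _ _ => mem_univ _) (fun σ _ => ?_)
  · rw [hf]; exact CharTwo.add_self_eq_zero _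
  · exact hij (Equiv.swap_eq_one_iff.1 (mul_eq_left.1 h))
  · simp [mul_assoc]

/-- The number of ways to complete a label to a fully labelled star simplex has a parity which does
not depend on that label. -/
theorem sum_rainbow_eq (l : (Fin 4 → ℤ) → Fin 4) (y : Fin 4 → ℤ) (a a' : Fin 4) :
    ∑ σ, rainbow a (l (y + offset σ 1)) (l (y + offset σ 2)) (l (y + offset σ 3)) =
      ∑ σ, rainbow a' (l (y + offset σ 1)) (l (y + offset σ 2)) (l (y + offset σ 3)) := by
  rw [← CharTwo.add_eq_zero, ← sum_add_distrib]
  simp_rw [rainbow_cocycle, sum_add_distrib]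
  -- Each sum omits one of the vertices 3, 1, 2, the only one altered by swapping the two steps
  -- adjacent to it; so its terms cancel in pairs.
  rw [sum_perm_eq_zero_of_swap (i := 2) (j := 3) (by decide),
    sum_perm_eq_zero_of_swap (i := 0) (j := 1) (by decide),
    sum_perm_eq_zero_of_swap (i := 1) (j := 2) (by decide)]
  · simp
  · intro σ
    have h1 : offset (σ * Equiv.swap 1 2) 1 = offset σ 1 := by revert σ; decide
    have h3 : offset (σ * Equiv.swap 1 2) 3 = offset σ 3 := by revert σ; decide
    rw [h1, h3]
  · intro σ
    have h2 : offset (σ * Equiv.swap 0 1) 2 = offset σ 2 := by revert σ; decide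
    have h3 : offset (σ * Equiv.swap 0 1) 3 = offset σ 3 := by revert σ; decide
    rw [h2, h3]
  · intro σ
    have h1 : offset (σ * Equiv.swap 2 3) 1 = offset σ 1 := by revert σ; decide
    have h2 : offset (σ * Equiv.swap 2 3) 2 = offset σ 2 := by revert σ; decide
    rw [h1, h2]

theorem sum_add_offset (x : Fin 4 → ℤ) (σ k) : ∑ i, (x + offset σ k) i = ∑ i, x i := by
  simp only [Pi.add_apply, sum_add_distrib, sum_offset, add_zero]

theorem mem_latticePoints {N : ℕ} {k : ZMod 4} {x : Fin 4 → ℤ} :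
    x ∈ latticePoints N k ↔ (∀ i, 0 ≤ x i) ∧ ∑ i, x i = N ∧ color x = k := by
  simp only [latticePoints, mem_filter, Fintype.mem_piFinset, mem_Icc]
  constructor
  · rintro ⟨h, h'⟩
    exact ⟨fun i => (h i).1, h'⟩
  · rintro ⟨h, h', h''⟩
    refine ⟨fun i => ⟨h i, ?_⟩, h', h''⟩
    rw [← h']
    exact single_le_sum (fun j _ => h j) (mem_univ i)

theorem fullyLabelled_surjective {l : (Fin 4 → ℤ) → Fin 4} {x : Fin 4 → ℤ}
    {σ : Equiv.Perm (Fin 4)} (h : fullyLabelled l x σ ≠ 0) (q : Fin 4) :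
    ∃ k, l (x + offset σ k) = q := by
  obtain ⟨k, hk⟩ := rainbow_surjective _ _ _ _ h q
  refine ⟨k, ?_⟩
  rw [← hk]
  fin_cases k <;> rfl

theorem fullyLabelled_injective {l : (Fin 4 → ℤ) → Fin 4} {x : Fin 4 → ℤ}
    {σ : Equiv.Perm (Fin 4)} (h : fullyLabelled l x σ ≠ 0) :
    Function.Injective fun k => l (x + offset σ k) := by
  intro j k hjk
  apply rainbow_injective _ _ _ _ h j k
  have h' (i : Fin 4) : ![l (x + offset σ 0), l (x + offset σ 1), l (x + offset σ 2), l (x + offset σ 3)] i =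
      l (x + offset σ i) := by fin_cases i <;> rfl
  rw [h', h']
  exact hjk

/-- A vertex labelled `q` has `q`-th coordinate at least 1, and coordinates vary by at most 1 within
a simplex. Hence fully labelled simplices never leave the dilated simplex, and the counts have no
boundary terms. -/
theorem IsSperner.nonneg {N : ℕ} {l : (Fin 4 → ℤ) → Fin 4} (hl : IsSperner N l)
    {x : Fin 4 → ℤ} (hx : ∑ i, x i = N) {σ : Equiv.Perm (Fin 4)} (h : fullyLabelled l x σ ≠ 0)
    (k q : Fin 4) : 0 ≤ (x + offset σ k) q := by
  obtain ⟨j, hj⟩ := fullyLabelled_surjective h q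
  have h1 : 0 < (x + offset σ j) q := by
    by_contra! h0
    exact hl _ ((sum_add_offset _ _ _).trans hx) q h0 hj
  have h2 := offset_sub_offset_le σ j k q
  simp only [Pi.add_apply] at h1 ⊢
  linarith

theorem fullyLabelled_rotate (l : (Fin 4 → ℤ) → Fin 4) (x : Fin 4 → ℤ) (σ : Equiv.Perm (Fin 4)) :
    fullyLabelled l (x + offset σ 1) (σ * finRotate 4) = fullyLabelled l x σ := by
  simp only [fullyLabelled, add_assoc, offset_rotate]
  exact rainbow_rotate _ _ _ _

theorem IsSperner.parity_add_one {N : ℕ} {l : (Fin 4 → ℤ) → Fin 4} (hl : IsSperner N l)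
    (k : ZMod 4) : parity N (k + 1) l = parity N k l := by
  simp only [parity, ← sum_product']
  symm
  refine Finset.sum_bij_ne_zero (fun p _ _ => (p.1 + offset p.2 1, p.2 * finRotate 4)) ?_ ?_ ?_ ?_
  · rintro ⟨x, σ⟩ hx h
    simp only [mem_product, mem_univ, and_true, mem_latticePoints] at hx ⊢
    refine ⟨fun i => hl.nonneg hx.2.1 h 1 i, (sum_add_offset _ _ _).trans hx.2.1, ?_⟩
    rw [color_add, color_offset, hx.2.2]
    simp
  · rintro ⟨x, σ⟩ _ _ ⟨y, τ⟩ _ _ h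
    obtain ⟨h1, h2⟩ := Prod.mk.inj h
    have h3 : σ = τ := mul_right_cancel h2
    subst h3
    simpa using h1
  · rintro ⟨y, τ⟩ hy h
    simp only [mem_product, mem_univ, and_true, mem_latticePoints] at hy
    obtain ⟨σ, rfl⟩ : ∃ σ, τ = σ * finRotate 4 := ⟨τ * (finRotate 4)⁻¹, by simp⟩
    obtain ⟨x, rfl⟩ : ∃ x, y = x + offset σ 1 := ⟨y - offset σ 1, by simp⟩
    have hx : ∑ i, x i = N := (sum_add_offset _ _ _).symm.trans hy.2.1
    have h' : fullyLabelled l x σ ≠ 0 := by rwa [fullyLabelled_rotate] at h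
    refine ⟨(x, σ), ?_, h', rfl⟩
    simp only [mem_product, mem_univ, and_true, mem_latticePoints]
    refine ⟨fun i => ?_, hx, ?_⟩
    · simpa [offset] using hl.nonneg hx h' 0 i
    · have := hy.2.2
      rw [color_add, color_offset] at this
      simpa using this
  · rintro ⟨x, σ⟩ _ _
    exact (fullyLabelled_rotate l x σ).symm

theorem IsSperner.parity_eq {N : ℕ} {l : (Fin 4 → ℤ) → Fin 4} (hl : IsSperner N l)
    (j k : ZMod 4) : parity N j l = parity N k l := by
  have (i : ℕ) : parity N (k + i) l = parity N k l := by
    induction i with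
    | zero => simp
    | succ i ih => rw [Nat.cast_succ, ← add_assoc, hl.parity_add_one, ih]
  simpa using this (j - k).val

/-- When base points have the colour of `y`, a counted simplex can contain `y` only as its base, so
`sum_rainbow_eq` applies to each star. -/
theorem parity_update {N : ℕ} (l : (Fin 4 → ℤ) → Fin 4) (y : Fin 4 → ℤ) (a : Fin 4) :
    parity N (color y) (Function.update l y a) = parity N (color y) l := by
  refine sum_congr rfl fun x hx => ?_
  have hne (σ) (k : Fin 4) (hk : k ≠ 0) : x + offset σ k ≠ y := by
    rintro rfl
    have := (mem_latticePoints.1 hx).2.2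
    rw [color_add, color_offset, left_eq_add] at this
    exact hk (eq_zero_of_natCast_eq_zero k this)
  have h0 (σ) : x + offset σ 0 = x := add_zero x
  simp only [fullyLabelled, h0]
  simp_rw [Function.update_of_ne (hne _ 1 (by decide)), Function.update_of_ne (hne _ 2 (by decide)),
    Function.update_of_ne (hne _ 3 (by decide))]
  exact sum_rainbow_eq _ _ _ _

/-- The labelling by the first positive coordinate. -/
def firstPositive (x : Fin 4 → ℤ) : Fin 4 :=
  if 0 < x 0 then 0 else if 0 < x 1 then 1 else if 0 < x 2 then 2 else 3

theorem isSperner_firstPositive {N : ℕ} (hN : 0 < N) : IsSperner N firstPositive := by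
  intro x hx q hq h
  rw [Fin.sum_univ_four] at hx
  have hN' : (0 : ℤ) < N := by exact_mod_cast hN
  unfold firstPositive at h
  split_ifs at h <;> subst h <;> linarith

theorem parity_firstPositive {N : ℕ} (hN : 0 < N) (k : ZMod 4) :
    parity N k firstPositive = 1 := by
  have hs := isSperner_firstPositive hN
  set z : Fin 4 → ℤ := Pi.single 3 (N : ℤ) with hz
  have hz0 : z 0 = 0 := rfl
  have hz1 : z 1 = 0 := rfl
  have hz2 : z 2 = 0 := rfl
  have hz3 : z 3 = N := rfl
  have hzs : ∑ i, z i = N := by simp [Fin.sum_univ_four, hz0, hz1, hz2, hz3]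
  -- Among nonnegative points only the corner `z` has label 3, so counting by the colour of `z`
  -- leaves only the star of `z`.
  rw [hs.parity_eq k (color z), parity, sum_eq_single z]
  -- The labelling ignores coordinate 3, so the star of `z` looks like that of the origin, a finite
  -- computation.
  · have h (o : Fin 4 → ℤ) : firstPositive (z + o) = firstPositive o := by
      simp [firstPositive, hz0, hz1, hz2]
    simp only [fullyLabelled, h]
    decide
  · intro x hx hxz
    obtain ⟨-, hxs, hxc⟩ := mem_latticePoints.1 hx
    refine sum_eq_zero fun σ _ => ?_
    by_contra h
    obtain ⟨j, hj⟩ := fullyLabelled_surjective h 3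
    have hnn := hs.nonneg hxs h j
    have hsum := (sum_add_offset x σ j).trans hxs
    have hv : x + offset σ j = z := by
      generalize x + offset σ j = w at hj hnn hsum
      have h0 := hnn 0
      have h1 := hnn 1
      have h2 := hnn 2
      rw [Fin.sum_univ_four] at hsum
      unfold firstPositive at hj
      split_ifs at hj
      all_goals try exact absurd hj (by decide)
      have e0 : w 0 = 0 := by omega
      have e1 : w 1 = 0 := by omega
      have e2 : w 2 = 0 := by omega
      funext i
      fin_cases i
      · exact e0
      · exact e1
      · exact e2
      · change w 3 = N
        omega
    have hc := congrArg color hv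
    rw [color_add, color_offset, hxc, add_eq_left] at hc
    have hj0 : j = 0 := eq_zero_of_natCast_eq_zero j hc
    subst hj0
    exact hxz (by simpa [offset] using hv)
  · intro h
    refine absurd (mem_latticePoints.2 ⟨fun i => ?_, hzs, rfl⟩) h
    fin_cases i <;> simp [z]

/-- Labels are corrected to `firstPositive` one point at a time. The Sperner condition is pointwise,
so it survives each change, and the base colour may be switched to that of the changed point. -/
theorem IsSperner.parity_eq_one {N : ℕ} (hN : 0 < N) (D : Finset (Fin 4 → ℤ)) :
    ∀ l : (Fin 4 → ℤ) → Fin 4, IsSperner N l → (∀ x ∉ D, l x = firstPositive x) →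
      parity N 0 l = 1 := by
  induction D using Finset.induction_on with
  | empty =>
    intro l _ h
    rw [show l = firstPositive from funext fun x => h x (by simp)]
    exact parity_firstPositive hN 0
  | insert y D _ ih =>
    intro l hl h
    have hl' : IsSperner N (Function.update l y (firstPositive y)) := by
      intro x hx q hq
      by_cases hxy : x = y
      · subst hxy
        rw [Function.update_self]
        exact isSperner_firstPositive hN x hx q hq
      · rw [Function.update_of_ne hxy]
        exact hl x hx q hq
    rw [hl.parity_eq 0 (color y), ← parity_update l y (firstPositive y), hl'.parity_eq _ 0]
    refine ih _ hl' fun x hx => ?_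
    by_cases hxy : x = y
    · subst hxy
      rw [Function.update_self]
    · rw [Function.update_of_ne hxy]
      exact h x (by simp [hxy, hx])

/-! ### Sperner's lemma and the colourful KKM theorem -/

/-- Sperner's lemma for the Freudenthal triangulation of the three-dimensional simplex. -/
theorem exists_fullyLabelled {N : ℕ} (hN : 0 < N) (l : (Fin 4 → ℤ) → Fin 4)
    (hl : ∀ x : Fin 4 → ℤ, (∀ i, 0 ≤ x i) → ∑ i, x i = N → ∀ q, x q = 0 → l x ≠ q) :
    ∃ x σ, (∀ k i, 0 ≤ (x + offset σ k) i) ∧ ∑ i, x i = N ∧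
      Function.Injective fun k => l (x + offset σ k) := by
  classical
  set D : Finset (Fin 4 → ℤ) := univ.biUnion (latticePoints N) with hD
  have memD {x} : x ∈ D ↔ (∀ i, 0 ≤ x i) ∧ ∑ i, x i = N := by
    simp [hD, mem_latticePoints]
  set l' : (Fin 4 → ℤ) → Fin 4 := fun x => if x ∈ D then l x else firstPositive x with hl'
  have hs : IsSperner N l' := by
    intro x hx q hq
    simp only [hl']
    split_ifs with h
    · exact hl x (memD.1 h).1 hx q (le_antisymm hq ((memD.1 h).1 q))
    · exact isSperner_firstPositive hN x hx q hq
  have hp := IsSperner.parity_eq_one hN D l' hs fun x hx => by simp [hl', hx]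
  obtain ⟨x, hx, h⟩ := exists_ne_zero_of_sum_ne_zero (by rw [← parity, hp]; decide)
  obtain ⟨σ, -, h⟩ := exists_ne_zero_of_sum_ne_zero h
  have hxs := (mem_latticePoints.1 hx).2.1
  have hnn := hs.nonneg hxs h
  refine ⟨x, σ, hnn, hxs, ?_⟩
  convert fullyLabelled_injective h using 2 with k
  simp only [hl']
  rw [if_pos (memD.2 ⟨hnn k, (sum_add_offset _ _ _).trans hxs⟩)]

/-- The colourful Knaster–Kuratowski–Mazurkiewicz theorem, for open sets, in dimension three. -/
theorem exists_perm_forall_mem (O : Fin 4 → Fin 4 → Set (Fin 4 → ℝ))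
    (hopen : ∀ i q, IsOpen (O i q)) (hcover : ∀ i, ∀ x ∈ stdSimplex ℝ (Fin 4), ∃ q, x ∈ O i q)
    (hface : ∀ i q, ∀ x ∈ stdSimplex ℝ (Fin 4), x ∈ O i q → x q ≠ 0) :
    ∃ x ∈ stdSimplex ℝ (Fin 4), ∃ π : Equiv.Perm (Fin 4), ∀ i, x ∈ O i (π i) := by
  have hleb (i) : ∃ δ > 0, ∀ x ∈ stdSimplex ℝ (Fin 4), ∃ q, Metric.ball x δ ⊆ O i q :=
    lebesgue_number_lemma_of_metric (isCompact_stdSimplex ℝ (Fin 4)) (hopen i) fun x hx =>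
      Set.mem_iUnion.2 (hcover i x hx)
  choose δ hδ hball using hleb
  obtain ⟨N, hN0, hN⟩ : ∃ N : ℕ, 0 < N ∧ ∀ i, 1 / (N : ℝ) < δ i := by
    choose n hn using fun i => exists_nat_one_div_lt (hδ i)
    refine ⟨∑ i, n i + 1, by positivity, fun i => lt_of_le_of_lt ?_ (hn i)⟩
    push_cast
    gcongr
    exact single_le_sum (f := fun j => (n j : ℝ)) (fun j _ => by positivity) (mem_univ i)
  have hNR : (0 : ℝ) < N := by exact_mod_cast hN0
  set φ : (Fin 4 → ℤ) → Fin 4 → ℝ := fun x i => x i / N with hφ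
  have hmem {x : Fin 4 → ℤ} (h : ∀ i, 0 ≤ x i) (hs : ∑ i, x i = N) :
      φ x ∈ stdSimplex ℝ (Fin 4) := by
    refine ⟨fun i => div_nonneg (by exact_mod_cast h i) hNR.le, ?_⟩
    simp only [hφ]
    rw [← sum_div, div_eq_one_iff_eq hNR.ne']
    exact_mod_cast hs
  -- A lattice point is labelled through the cover indexed by its own colour. A fully labelled
  -- simplex has every colour and every label once, and matching them gives the permutation.
  have hlab (x : Fin 4 → ℤ) : ∃ q, φ x ∈ stdSimplex ℝ (Fin 4) →
      Metric.ball (φ x) (δ (color x)) ⊆ O (color x) q := by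
    by_cases h : φ x ∈ stdSimplex ℝ (Fin 4)
    · obtain ⟨q, hq⟩ := hball (color x) _ h
      exact ⟨q, fun _ => hq⟩
    · exact ⟨0, fun h' => absurd h' h⟩
  choose l hl using hlab
  obtain ⟨x, σ, hnn, hxs, hinj⟩ := exists_fullyLabelled hN0 l fun x h hs q hq hlq => by
    have hx := hmem h hs
    refine hface _ _ _ hx (hl x hx (Metric.mem_ball_self (hδ _))) ?_
    simp [hφ, hlq, hq]
  have hvs (k) : ∑ i, (x + offset σ k) i = N := (sum_add_offset _ _ _).trans hxs
  have hv (k) := hmem (hnn k) (hvs k)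
  let κ : Fin 4 → Fin 4 := fun k => color (x + offset σ k)
  have hκ : Function.Injective κ := by
    intro j k hjk
    change color _ = color _ at hjk
    rw [color_add, color_add, color_offset, color_offset, add_right_inj] at hjk
    revert j k; decide
  let eκ : Equiv.Perm (Fin 4) := Equiv.ofBijective κ hκ.bijective_of_finite
  let el : Equiv.Perm (Fin 4) := Equiv.ofBijective _ hinj.bijective_of_finite
  refine ⟨φ (x + offset σ 0), hv 0, eκ.symm.trans el, fun i => ?_⟩
  obtain ⟨k, rfl⟩ := eκ.surjective i
  rw [Equiv.trans_apply, Equiv.symm_apply_apply]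
  -- The mesh 1/N is below every Lebesgue number, so the base vertex lies in the ball around each
  -- other vertex.
  refine hl (x + offset σ k) (hv k) ?_
  refine lt_of_le_of_lt ?_ (hN (color (x + offset σ k)))
  rw [dist_pi_le_iff (by positivity)]
  intro q
  have h1 := offset_sub_offset_le σ 0 k q
  have h2 := offset_sub_offset_le σ k 0 q
  rw [Real.dist_eq]
  simp only [hφ, ← sub_div, abs_div, abs_of_pos hNR, Pi.add_apply]
  gcongr
  have h1' : (offset σ 0 q : ℝ) - offset σ k q ≤ 1 := by exact_mod_cast h1
  have h2' : (offset σ k q : ℝ) - offset σ 0 q ≤ 1 := by exact_mod_cast h2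
  rw [abs_le]
  push_cast
  constructor <;> linarith

end SimplexLattice

namespace LinePiercing

/-! ### Lines, equations and signs on convex sets -/

/-- A nonzero linear equation cuts out a line. -/
theorem exists_isLine_of_equation {a b : ℝ} (hab : a ≠ 0 ∨ b ≠ 0) (c : ℝ) :
    ∃ l : AffineSubspace ℝ Plane, IsLine l ∧ l.direction = Submodule.span ℝ {!₂[b, -a]} ∧
      ∀ p : Plane, p ∈ l ↔ a * p 0 + b * p 1 = c := by
  have hpos : a ^ 2 + b ^ 2 ≠ 0 := by
    rcases hab with h | h <;> positivity
  have hu : (!₂[b, -a] : Plane) ≠ 0 := by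
    intro h
    have h0 := congrArg (fun p : Plane => p 0) h
    have h1 := congrArg (fun p : Plane => p 1) h
    simp at h0 h1
    rcases hab with h | h <;> contradiction
  refine ⟨AffineSubspace.mk' !₂[c * a / (a ^ 2 + b ^ 2), c * b / (a ^ 2 + b ^ 2)]
    (Submodule.span ℝ {!₂[b, -a]}), ?_, AffineSubspace.direction_mk' _ _, fun p => ?_⟩
  · rw [IsLine, AffineSubspace.direction_mk']
    exact finrank_span_singleton hu
  · rw [AffineSubspace.mem_mk', Submodule.mem_span_singleton]
    constructor
    · rintro ⟨r, hr⟩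
      have h0 := congrArg (fun p : Plane => p 0) hr
      have h1 := congrArg (fun p : Plane => p 1) hr
      simp at h0 h1
      have e0 : p 0 = c * a / (a ^ 2 + b ^ 2) + r * b := by linarith
      have e1 : p 1 = c * b / (a ^ 2 + b ^ 2) - r * a := by linarith
      rw [e0, e1]
      field_simp
      ring
    · intro hp
      refine ⟨(b * p 0 - a * p 1) / (a ^ 2 + b ^ 2), ?_⟩
      ext i
      fin_cases i
      · simp
        field_simp
        rw [← hp]
        ring
      · simp
        field_simp
        rw [← hp]
        ring

theorem exists_isLine_ne (l : AffineSubspace ℝ Plane) :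
    ∃ l' : AffineSubspace ℝ Plane, IsLine l' ∧ l ≠ l' := by
  obtain ⟨l₀, h₀, -, hm₀⟩ := exists_isLine_of_equation (a := 1) (b := 0) (by simp) 0
  obtain ⟨l₁, h₁, -, hm₁⟩ := exists_isLine_of_equation (a := 1) (b := 0) (by simp) 1
  by_cases h : l = l₀
  · refine ⟨l₁, h₁, ?_⟩
    rintro rfl
    have e₀ := (hm₀ 0).2 (by simp)
    rw [← h, hm₁] at e₀
    simp at e₀
  · exact ⟨l₀, h₀, h⟩

/-- The zero set of a nonzero affine function is covered by any given line and one more line. -/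
theorem exists_isLine_ne_of_equation {a b c : ℝ} (habc : a ≠ 0 ∨ b ≠ 0 ∨ c ≠ 0)
    (l : AffineSubspace ℝ Plane) :
    ∃ l' : AffineSubspace ℝ Plane, IsLine l' ∧ l ≠ l' ∧
      ∀ p : Plane, a * p 0 + b * p 1 = c → p ∈ l ∨ p ∈ l' := by
  obtain ⟨l₂, h₂, hne⟩ := exists_isLine_ne l
  by_cases hab : a ≠ 0 ∨ b ≠ 0
  · obtain ⟨l₁, h₁, -, hm⟩ := exists_isLine_of_equation hab c
    by_cases h : l = l₁
    · exact ⟨l₂, h₂, hne, fun p hp => Or.inl (h ▸ (hm p).2 hp)⟩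
    · exact ⟨l₁, h₁, h, fun p hp => Or.inr ((hm p).2 hp)⟩
  · push Not at hab
    refine ⟨l₂, h₂, hne, fun p hp => absurd hp ?_⟩
    simp only [hab.1, hab.2, zero_mul, add_zero]
    simpa [hab.1, hab.2, eq_comm] using habc

theorem forall_neg_or_forall_pos {A : Set Plane} (hA : Convex ℝ A) {f : Plane → ℝ}
    (hf : Continuous f) (h0 : ∀ p ∈ A, f p ≠ 0) : (∀ p ∈ A, f p < 0) ∨ ∀ p ∈ A, 0 < f p := by
  by_contra! h
  obtain ⟨⟨p, hp, hp'⟩, q, hq, hq'⟩ := h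
  obtain ⟨z, hz, hz'⟩ := hA.isPreconnected.intermediate_value hq hp hf.continuousOn ⟨hq', hp'⟩
  exact h0 z hz hz'

theorem isOpen_setOf_forall_neg {A : Set Plane} (hA : IsCompact A)
    {g : (Fin 4 → ℝ) → Plane → ℝ} (hg : Continuous fun z : (Fin 4 → ℝ) × Plane => g z.1 z.2) :
    IsOpen {x | ∀ p ∈ A, g x p < 0} := by
  rw [isOpen_iff_mem_nhds]
  intro x hx
  refine hA.eventually_forall_of_forall_eventually fun p hp => ?_
  exact (isOpen_lt hg continuous_const).mem_nhds (hx p hp)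

/-! ### The two lines attached to a point of the simplex -/

/-- The height of the first line that corresponds to a point of the simplex. -/
def height (x : Fin 4 → ℝ) : ℝ := x 0 + x 1

/-- The coordinates of a point of the simplex, the first pair increased when the first line is low,
the second pair when it is high. -/
noncomputable def weight (x : Fin 4 → ℝ) : Fin 4 → ℝ :=
  ![x 0 + max 0 (1 / 4 - height x), x 1 + max 0 (1 / 4 - height x),
    x 2 + max 0 (height x - 3 / 4), x 3 + max 0 (height x - 3 / 4)]

/-- The coefficient of the first coordinate in the equation of the second line. -/
noncomputable def coeffFst (x : Fin 4 → ℝ) : ℝ := weight x 0 * weight x 1 * weight x 2 * weight x 3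

/-- The coefficient of the second coordinate in the equation of the second line. -/
noncomputable def coeffSnd (x : Fin 4 → ℝ) : ℝ := weight x 0 * weight x 3 - weight x 1 * weight x 2

/-- The value of the equation of the second line on the first line, at first coordinate zero. -/
noncomputable def coeffConst (x : Fin 4 → ℝ) : ℝ :=
  weight x 1 * weight x 3 - weight x 0 * weight x 2

/-- The affine function, in coordinates `s` and `t`, whose zero set is the second line that
corresponds to a point of the simplex. -/
noncomputable def tilt (x : Fin 4 → ℝ) (s t : ℝ) : ℝ :=
  coeffFst x * s + coeffSnd x * (t - height x) + coeffConst x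

/-- The sign, in a quadrant, of the function that vanishes on the first line, negated. -/
def signFst : Fin 4 → ℝ := ![1, 1, -1, -1]

/-- The sign, in a quadrant, of the function that vanishes on the second line, negated. -/
def signSnd : Fin 4 → ℝ := ![1, -1, 1, -1]

/-- Two affine functions on the real line do not realise all four pairs of signs. -/
theorem not_all_signs {u₀ u₁ w₀ w₁ : ℝ} {r : Fin 4 → ℝ}
    (hu : ∀ q, signFst q * (u₀ + u₁ * r q) < 0) (hw : ∀ q, signSnd q * (w₀ + w₁ * r q) < 0) :
    False := by
  simp only [Fin.forall_fin_succ, Fin.succ_zero_eq_one, Fin.succ_one_eq_two, signFst, signSnd,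
    Matrix.cons_val, IsEmpty.forall_iff, and_true] at hu hw
  obtain ⟨hu0, hu1, hu2, hu3⟩ := hu
  obtain ⟨hw0, hw1, hw2, hw3⟩ := hw
  simp only [show Fin.succ (2 : Fin 3) = 3 from rfl, Matrix.cons_val] at hu3 hw3
  -- From quadrant 0 to 3 both functions increase, so their slopes have the same sign; from 1 to 2
  -- one increases and the other decreases, so the signs are opposite.
  have a1 : 0 < u₁ * (r 3 - r 0) := by linarith
  have a2 : 0 < w₁ * (r 3 - r 0) := by linarith
  have a3 : 0 < u₁ * (r 2 - r 1) := by linarith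
  have a4 : 0 < w₁ * (r 1 - r 2) := by linarith
  nlinarith [mul_pos (mul_pos a1 a4) (mul_pos a2 a3), mul_nonneg (mul_self_nonneg (u₁ * w₁))
    (mul_self_nonneg ((r 3 - r 0) * (r 2 - r 1)))]

theorem weight_nonneg {x : Fin 4 → ℝ} (hx : x ∈ stdSimplex ℝ (Fin 4)) (q : Fin 4) :
    0 ≤ weight x q := by
  have h := hx.1
  fin_cases q
  · exact add_nonneg (h 0) (le_max_left _ _)
  · exact add_nonneg (h 1) (le_max_left _ _)
  · exact add_nonneg (h 2) (le_max_left _ _)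
  · exact add_nonneg (h 3) (le_max_left _ _)

theorem coeff_ne_zero {x : Fin 4 → ℝ} (hx : x ∈ stdSimplex ℝ (Fin 4)) :
    coeffFst x ≠ 0 ∨ coeffSnd x ≠ 0 ∨ coeffConst x ≠ 0 := by
  by_contra! h
  obtain ⟨h1, h2, h3⟩ := h
  have hn := weight_nonneg hx
  -- The corrections in `weight` serve to keep both pair sums positive; without them all
  -- coefficients would vanish at heights 0 and 1.
  have hlow : 0 < weight x 0 + weight x 1 := by
    have := le_max_right 0 (1 / 4 - height x)
    have h0 := le_max_left 0 (1 / 4 - height x)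
    have : weight x 0 + weight x 1 = height x + 2 * max 0 (1 / 4 - height x) := by
      simp [weight, height]; ring
    linarith
  have hhigh : 0 < weight x 2 + weight x 3 := by
    have := le_max_right 0 (height x - 3 / 4)
    have h0 := le_max_left 0 (height x - 3 / 4)
    have hs := hx.2
    rw [Fin.sum_univ_four] at hs
    have : weight x 2 + weight x 3 = 1 - height x + 2 * max 0 (height x - 3 / 4) := by
      simp [weight, height]; linarith
    linarith
  unfold coeffFst at h1
  unfold coeffSnd at h2
  unfold coeffConst at h3
  generalize weight x 0 = a at *
  generalize weight x 1 = b at *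
  generalize weight x 2 = c at *
  generalize weight x 3 = d at *
  -- Some weight is zero, so its partner is positive, and the two other equations then kill the
  -- opposite pair.
  rcases mul_eq_zero.1 h1 with h1 | rfl
  · rcases mul_eq_zero.1 h1 with h1 | rfl
    · rcases mul_eq_zero.1 h1 with rfl | rfl
      · have hb : b ≠ 0 := by linarith
        have hc : c = 0 := by simpa [hb] using h2
        have hd : d = 0 := by simpa [hb] using h3
        linarith
      · have ha : a ≠ 0 := by linarith
        have hc : c = 0 := by simpa [ha] using h3
        have hd : d = 0 := by simpa [ha] using h2
        linarith
    · have hd : d ≠ 0 := by linarith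
      have ha : a = 0 := by simpa [hd] using h2
      have hb : b = 0 := by simpa [hd] using h3
      linarith
  · have hc : c ≠ 0 := by linarith
    have ha : a = 0 := by simpa [hc] using h3
    have hb : b = 0 := by simpa [hc] using h2
    linarith

/-- On a facet of the simplex the corresponding quadrant misses the strip `1 / 4 ≤ t ≤ 3 / 4`. -/
theorem coord_ne_zero {x : Fin 4 → ℝ} (hx : x ∈ stdSimplex ℝ (Fin 4)) {s t : ℝ}
    (ht : 1 / 4 ≤ t) (ht' : t ≤ 3 / 4) {q : Fin 4} (h1 : signFst q * (t - height x) < 0)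
    (h2 : signSnd q * tilt x s t < 0) : x q ≠ 0 := by
  intro hq
  have hn := weight_nonneg hx
  -- A point of the strip below the first line forces `height x > 1/4`, so the correction is
  -- inactive; the case above is symmetric.
  have hlow (h : t < height x) (q) (hq2 : q = 0 ∨ q = 1) (hq : x q = 0) : weight x q = 0 := by
    have : max 0 (1 / 4 - height x) = 0 := max_eq_left (by linarith)
    rcases hq2 with rfl | rfl <;> simp only [weight, this, hq, Matrix.cons_val, add_zero]
  have hhigh (h : height x < t) (q) (hq2 : q = 2 ∨ q = 3) (hq : x q = 0) : weight x q = 0 := by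
    have : max 0 (height x - 3 / 4) = 0 := max_eq_left (by linarith)
    rcases hq2 with rfl | rfl <;> simp only [weight, this, hq, Matrix.cons_val, add_zero]
  unfold tilt coeffFst coeffSnd coeffConst at h2
  -- When weight `q` vanishes so does the coefficient of `s`, and the two remaining terms of `tilt`
  -- both weakly have the sign excluded by quadrant `q`.
  fin_cases q <;> simp [signFst, signSnd] at h1 h2 hq
  · rw [hlow h1 0 (by simp) hq] at h2
    nlinarith [mul_nonneg (hn 1) (hn 3), mul_nonneg (mul_nonneg (hn 1) (hn 2)) (sub_nonneg.2 h1.le)]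
  · rw [hlow h1 1 (by simp) hq] at h2
    nlinarith [mul_nonneg (hn 0) (hn 2), mul_nonneg (mul_nonneg (hn 0) (hn 3)) (sub_nonneg.2 h1.le)]
  · rw [hhigh h1 2 (by simp) hq] at h2
    nlinarith [mul_nonneg (hn 1) (hn 3), mul_nonneg (mul_nonneg (hn 0) (hn 3)) (sub_nonneg.2 h1.le)]
  · rw [hhigh h1 3 (by simp) hq] at h2
    nlinarith [mul_nonneg (hn 0) (hn 2), mul_nonneg (mul_nonneg (hn 1) (hn 2)) (sub_nonneg.2 h1.le)]

theorem continuous_height : Continuous height := by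
  unfold height; fun_prop

theorem continuous_weight (q : Fin 4) : Continuous fun x => weight x q := by
  have := continuous_height
  fin_cases q <;> simp [weight] <;> fun_prop

theorem continuous_tilt : Continuous fun z : (Fin 4 → ℝ) × ℝ × ℝ => tilt z.1 z.2.1 z.2.2 := by
  have h := continuous_height
  have h' := continuous_weight
  unfold tilt coeffFst coeffSnd coeffConst
  fun_prop

/-- The points `x` whose `q`-th open quadrant, in coordinates `s` and `t`, contains a member
of `F`. -/
def quadrantCover (s t : Plane → ℝ) (F : Set (Set Plane)) (q : Fin 4) : Set (Fin 4 → ℝ) :=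
  {x | ∃ A ∈ F, ∀ p ∈ A, signFst q * (t p - height x) < 0 ∧ signSnd q * tilt x (s p) (t p) < 0}

theorem isOpen_quadrantCover {s t : Plane → ℝ} (hs : Continuous s) (ht : Continuous t)
    {F : Set (Set Plane)} (hF : ∀ A ∈ F, IsCompact A) (q : Fin 4) :
    IsOpen (quadrantCover s t F q) := by
  have : quadrantCover s t F q = ⋃ A ∈ F, ({x | ∀ p ∈ A, signFst q * (t p - height x) < 0} ∩
      {x | ∀ p ∈ A, signSnd q * tilt x (s p) (t p) < 0}) := by
    ext x
    simp only [quadrantCover, forall_and, Set.mem_ofPred_eq, Set.mem_iUnion, Set.mem_inter_iff,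
      exists_prop]
  rw [this]
  refine isOpen_biUnion fun A hA => (isOpen_setOf_forall_neg (hF A hA) ?_).inter
    (isOpen_setOf_forall_neg (hF A hA) ?_)
  · have := continuous_height
    fun_prop
  · exact continuous_const.mul (continuous_tilt.comp
      (continuous_fst.prodMk ((hs.comp continuous_snd).prodMk (ht.comp continuous_snd))))

theorem exists_mem_quadrantCover {s t : Plane → ℝ} (hs : Continuous s) (ht : Continuous t)
    {F : Set (Set Plane)} (hF : ∀ A ∈ F, Convex ℝ A) {x : Fin 4 → ℝ} {A : Set Plane} (hA : A ∈ F)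
    (h1 : ∀ p ∈ A, t p - height x ≠ 0) (h2 : ∀ p ∈ A, tilt x (s p) (t p) ≠ 0) :
    ∃ q, x ∈ quadrantCover s t F q := by
  have c2 : Continuous fun p => tilt x (s p) (t p) :=
    continuous_tilt.comp (continuous_const.prodMk (hs.prodMk ht))
  rcases forall_neg_or_forall_pos (f := fun p => t p - height x) (hF A hA)
    (ht.sub continuous_const) h1 with k1 | k1 <;>
  rcases forall_neg_or_forall_pos (hF A hA) c2 h2 with k2 | k2
  · exact ⟨0, A, hA, fun p hp => by
      simp only [signFst, signSnd, Matrix.cons_val]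
      constructor <;> linarith [k1 p hp, k2 p hp]⟩
  · exact ⟨1, A, hA, fun p hp => by
      simp only [signFst, signSnd, Matrix.cons_val]
      constructor <;> linarith [k1 p hp, k2 p hp]⟩
  · exact ⟨2, A, hA, fun p hp => by
      simp only [signFst, signSnd, Matrix.cons_val]
      constructor <;> linarith [k1 p hp, k2 p hp]⟩
  · exact ⟨3, A, hA, fun p hp => by
      simp only [signFst, signSnd, Matrix.cons_val]
      constructor <;> linarith [k1 p hp, k2 p hp]⟩

/-- No line meets all four open quadrants. -/
theorem not_line_meets_quadrants {a b c a' b' c' : ℝ} {s t : Plane → ℝ}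
    (hs : ∀ p, s p = a * p 0 + b * p 1 + c) (ht : ∀ p, t p = a' * p 0 + b' * p 1 + c')
    (x : Fin 4 → ℝ) {l : AffineSubspace ℝ Plane} (hl : IsLine l) {p : Fin 4 → Plane}
    (hp : ∀ q, p q ∈ l) (h1 : ∀ q, signFst q * (t (p q) - height x) < 0)
    (h2 : ∀ q, signSnd q * tilt x (s (p q)) (t (p q)) < 0) : False := by
  obtain ⟨u, -, hu⟩ := finrank_eq_one_iff'.1 hl
  choose r hr using fun q => hu ⟨_, AffineSubspace.vsub_mem_direction (hp q) (hp 0)⟩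
  have hr' (q) : p q = p 0 + r q • (u : Plane) := by
    have := congrArg Subtype.val (hr q)
    simp only [Submodule.coe_smul, vsub_eq_sub] at this
    rw [this]; abel
  have e1 (q) : t (p q) - height x = (t (p 0) - height x) +
      (a' * (u : Plane) 0 + b' * (u : Plane) 1) * r q := by
    rw [ht (p q), ht (p 0), hr' q]
    simp only [PiLp.add_apply, PiLp.smul_apply, smul_eq_mul]
    ring
  have e2 (q) : tilt x (s (p q)) (t (p q)) = tilt x (s (p 0)) (t (p 0)) +
      (coeffFst x * (a * (u : Plane) 0 + b * (u : Plane) 1) +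
        coeffSnd x * (a' * (u : Plane) 0 + b' * (u : Plane) 1)) * r q := by
    unfold tilt
    rw [ht (p q), ht (p 0), hs (p q), hs (p 0), hr' q]
    simp only [PiLp.add_apply, PiLp.smul_apply, smul_eq_mul]
    ring
  exact not_all_signs (fun q => e1 q ▸ h1 q) fun q => e2 q ▸ h2 q

end LinePiercing

/-! ### The piercing theorem -/

open LinePiercing in
theorem mainTheorem2
    (F : Fin 4 → Set (Set LinePiercing.Plane))
    (hfin : ∀ i, (F i).Finite)
    (hcompact : ∀ i, ∀ A ∈ F i, IsCompact A)
    (hconvex : ∀ i, ∀ A ∈ F i, Convex ℝ A)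
    (hline : ∀ A : Fin 4 → Set LinePiercing.Plane, (∀ i, A i ∈ F i) →
      ∃ l : AffineSubspace ℝ LinePiercing.Plane, LinePiercing.IsLine l ∧
        LinePiercing.Pierces (l : Set LinePiercing.Plane) (Set.range A))
    (v : LinePiercing.Plane) (hv : v ≠ 0) :
    ∃ i : Fin 4, ∃ l₁ l₂ : AffineSubspace ℝ LinePiercing.Plane,
      LinePiercing.IsLine l₁ ∧ LinePiercing.IsLine l₂ ∧ l₁ ≠ l₂ ∧
        l₁.direction = Submodule.span ℝ {v} ∧
        LinePiercing.Pierces ((l₁ : Set LinePiercing.Plane) ∪ (l₂ : Set LinePiercing.Plane))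
          (F i) := by
  have hv' : v 0 ≠ 0 ∨ v 1 ≠ 0 := by
    by_contra! h
    exact hv (by ext i; fin_cases i <;> simp [h.1, h.2])
  obtain ⟨C, hC⟩ : ∃ C, ∀ i, ∀ A ∈ F i, ∀ p ∈ A, |-v 1 * p 0 + v 0 * p 1| ≤ C := by
    have hK : IsCompact (⋃ i, ⋃ A ∈ F i, A) :=
      isCompact_iUnion fun i => (hfin i).isCompact_biUnion (hcompact i)
    obtain ⟨C, hC⟩ := hK.exists_bound_of_continuousOn
      (f := fun p : Plane => -v 1 * p 0 + v 0 * p 1) (by fun_prop)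
    exact ⟨C, fun i A hA p hp => hC p (Set.mem_iUnion.2 ⟨i, Set.mem_biUnion hA hp⟩)⟩
  obtain ⟨k, hk, hkC⟩ : ∃ k : ℝ, 0 < k ∧ k * C ≤ 1 / 4 := by
    refine ⟨1 / (4 * (|C| + 1)), by positivity, ?_⟩
    rw [div_mul_eq_mul_div, div_le_iff₀ (by positivity)]
    linarith [le_abs_self C]
  set s : Plane → ℝ := fun p => v 0 * p 0 + v 1 * p 1 with hs
  set t : Plane → ℝ := fun p => k * (-v 1 * p 0 + v 0 * p 1) + 1 / 2 with ht
  have hsc : Continuous s := by fun_prop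
  have htc : Continuous t := by fun_prop
  have htb {i A} (hA : A ∈ F i) {p} (hp : p ∈ A) : 1 / 4 ≤ t p ∧ t p ≤ 3 / 4 := by
    have := abs_le.1 (hC i A hA p hp)
    simp only [ht]
    constructor <;> nlinarith
  have hline₁ (h : ℝ) : ∃ l : AffineSubspace ℝ Plane, IsLine l ∧
      l.direction = Submodule.span ℝ {v} ∧ ∀ p, p ∈ l ↔ t p - h = 0 := by
    obtain ⟨l, h1, h2, h3⟩ := exists_isLine_of_equation (a := -v 1) (b := v 0)
      (by simpa [or_comm] using hv') ((h - 1 / 2) / k)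
    refine ⟨l, h1, ?_, fun p => ?_⟩
    · rw [h2]
      congr
      ext i
      fin_cases i <;> simp
    · rw [h3, eq_div_iff hk.ne']
      simp only [ht]
      constructor <;> intro h <;> linarith
  by_contra! H
  have hne (i) : (F i).Nonempty := by
    by_contra! h
    obtain ⟨l₁, h1, hd, -⟩ := hline₁ 0
    obtain ⟨l₂, h2, h12⟩ := exists_isLine_ne l₁
    exact H i l₁ l₂ h1 h2 h12 hd fun A hA => by simp [h] at hA
  -- An empty member would lie vacuously in every quadrant and spoil the facet condition; it is
  -- excluded because a line meets every member of a full choice.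
  have hAne {i A} (hA : A ∈ F i) : A.Nonempty := by
    choose B hB using hne
    obtain ⟨l, -, hl⟩ := hline (Function.update B i A) fun j => by
      by_cases hj : j = i
      · subst hj; simpa using hA
      · simpa [hj] using hB j
    exact (hl A ⟨i, by simp⟩).mono Set.inter_subset_right
  obtain ⟨x, -, π, hπ⟩ := SimplexLattice.exists_perm_forall_mem
    (fun i q => quadrantCover s t (F i) q)
    (fun i q => isOpen_quadrantCover hsc htc (hcompact i) q)
    (fun i x hx => by
      obtain ⟨l₁, h1, hd, hm₁⟩ := hline₁ (height x)
      have hvv : 0 < v 0 ^ 2 + v 1 ^ 2 := by rcases hv' with h | h <;> positivity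
      -- This is `tilt x (s p) (t p) = 0` written in the coordinates of `p`. The zero set may be
      -- empty or equal to the first line; then any other line serves as `l₂`.
      obtain ⟨l₂, h2, h12, hm₂⟩ := exists_isLine_ne_of_equation
        (a := coeffFst x * v 0 - coeffSnd x * k * v 1) (b := coeffFst x * v 1 + coeffSnd x * k * v 0)
        (c := - (coeffSnd x * (1 / 2 - height x) + coeffConst x)) (by
          by_contra! h
          obtain ⟨ha, hb, hc⟩ := h
          have e1 : coeffFst x * (v 0 ^ 2 + v 1 ^ 2) = 0 := by linear_combination v 0 * ha + v 1 * hb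
          have e2 : coeffSnd x * k * (v 0 ^ 2 + v 1 ^ 2) = 0 := by
            linear_combination v 0 * hb - v 1 * ha
          have e1' : coeffFst x = 0 := by simpa [hvv.ne'] using e1
          have e2' : coeffSnd x = 0 := by simpa [hvv.ne', hk.ne'] using e2
          have e3' : coeffConst x = 0 := by simpa [e2'] using hc
          simpa [e1', e2', e3'] using coeff_ne_zero hx) l₁
      have hnp := H i l₁ l₂ h1 h2 h12 hd
      unfold Pierces at hnp
      push Not at hnp
      obtain ⟨A, hA, hdis⟩ := hnp
      have hout {p} (hp : p ∈ A) : ¬ (p ∈ l₁ ∨ p ∈ l₂) := fun h =>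
        Set.notMem_empty p (hdis ▸ ⟨h, hp⟩)
      refine exists_mem_quadrantCover hsc htc (hconvex i) hA (fun p hp h => ?_) fun p hp h => ?_
      · exact hout hp (Or.inl ((hm₁ p).2 h))
      · refine hout hp (hm₂ p ?_)
        simp only [tilt, hs, ht] at h
        linear_combination h)
    (fun i q x hx ⟨A, hA, h⟩ => by
      obtain ⟨p, hp⟩ := hAne hA
      exact coord_ne_zero hx (htb hA hp).1 (htb hA hp).2 (h p hp).1 (h p hp).2)
  choose A hA hAq using hπ
  obtain ⟨l, hl, hlA⟩ := hline A hA
  choose p hpl hpA using fun i => hlA (A i) ⟨i, rfl⟩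
  refine not_line_meets_quadrants (s := s) (t := t) (a := v 0) (b := v 1) (c := 0)
    (a' := -k * v 1) (b' := k * v 0) (c' := 1 / 2) (fun p => by simp [hs])
    (fun p => by simp only [ht]; ring) x hl (p := fun q => p (π.symm q)) (fun q => hpl _)
    (fun q => ?_) (fun q => ?_)
  · simpa using (hAq (π.symm q) _ (hpA _)).1
  · simpa using (hAq (π.symm q) _ (hpA _)).2
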